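/- Let $\mathcal H,\mathcal K$ be separable complex Hilbert spaces, let $U$ be a unitary operator on $\mathcal H$ with spectral decomposition $U=\int_{[0,2\pi)} e^{-i\theta}\,E(d\theta)$, let $A:\mathcal H\to\mathcal K$ be a closed, densely defined linear operator, and let $J\subseteq[0,2\pi)$. For $x\in\mathcal H$ let $m_x(S)=\langle E(S)x,x\rangle$ be the spectral measure of $x$, and let $m_x=m_x^{ac}+m_x^{s}$ be its Lebesgue decomposition with respect to Lebesgue measure (so $m_x^s$ is the sum of the pure point and singular continuous parts). Put $F(z;U)=(1-Ue^{iz})^{-1}$ and, for $\varepsilon>0$ and $\theta\in[0,2\pi)$, $$G_\varepsilon(\theta;U,A)=A\,F(\theta+i\varepsilon;U)^*\,F(\theta+i\varepsilon;U)\,A^*$$ on its natural domain in $\mathcal K$. We say that $\operatorname{s-lim}_{\varepsilon\downarrow0}G_\varepsilon(\theta;U,A)$ exists if, for every $\varepsilon>0$, $G_\varepsilon(\theta;U,A)$ has a bounded extension to $\mathcal K$ and these extensions converge strongly to a bounded operator on $\mathcal K$ as $\varepsilon\downarrow0$. The operator $A$ is called $U$-finite on $J$ if this strong limit exists for Lebesgue-almost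 every $\theta\in J$, and $$N(U,A,J)=\{\theta\in J:\ \operatorname{s-lim}_{\varepsilon\downarrow0}G_\varepsilon(\theta;U,A)\text{ does not exist}\}.$$ The range $R(A^*)$ is called cyclic for $U$ if the smallest closed subspace of $\mathcal H$ that contains $R(A^*)$ and reduces $U$ (that is, it and its orthogonal complement are invariant under $U$) is $\mathcal H$. **Theorem.** If $A$ is $U$-finite on $J$ and $R(A^*)$ is cyclic for $U$, then 1. $U$ has no absolutely continuous spectrum in $J$: $m_x^{ac}(J)=0$ for every $x\in\mathcal H$; 2. $N(U,A,J)$ has Lebesgue measure zero, and the singular spectrum of $U$ in $J$ is supported by $N(U,A,J)$: $m_x^{s}(J\setminus N(U,A,J))=0$ for every $x\in\mathcal H$. (If $J$ is not Borel, the measures in 1 and 2 are understood as outer measures.) -/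

import Mathlib

open MeasureTheory Filter Topology
open scoped ComplexConjugate

namespace Floquet

noncomputable section

section SpectralMeasure

variable {H : Type*} [NormedAddCommGroup H] [InnerProductSpace ℂ H] [CompleteSpace H]

theorem isStarNormal_unitary (U : unitary (H →L[ℂ] H)) : IsStarNormal (U : H →L[ℂ] H) :=
  ⟨((Unitary.star_mul_self_of_mem U.2).trans (Unitary.mul_star_self_of_mem U.2).symm)⟩

/-- The continuous functional calculus `f ↦ f(U)` of a unitary operator `U`, for continuous complex
functions `f` on the spectrum of `U`. -/
def calculus (U : unitary (H →L[ℂ] H)) :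
    C(spectrum ℂ (U : H →L[ℂ] H), ℂ) →⋆ₐ[ℂ] (H →L[ℂ] H) :=
  cfcHom (isStarNormal_unitary U)

/-- A real continuous function regarded as a complex one. -/
def toComplex {X : Type*} [TopologicalSpace X] (f : C(X, ℝ)) : C(X, ℂ) :=
  ⟨fun t => (f t : ℂ), by fun_prop⟩

theorem calculus_nonneg (U : unitary (H →L[ℂ] H)) (x : H)
    (f : C(spectrum ℂ (U : H →L[ℂ] H), ℝ)) (hf : ∀ t, 0 ≤ f t) :
    0 ≤ (inner ℂ x (calculus U (toComplex f) x)).re := by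
  have hsqrt : toComplex f = star (toComplex ⟨fun t => Real.sqrt (f t), by fun_prop⟩) *
      toComplex ⟨fun t => Real.sqrt (f t), by fun_prop⟩ := by
    ext t
    have h2 : Real.sqrt (f t) * Real.sqrt (f t) = f t := Real.mul_self_sqrt (hf t)
    simp [toComplex, ← Complex.ofReal_mul, h2]
  rw [hsqrt, map_mul, map_star, mul_apply_eq_comp,
    ContinuousLinearMap.star_eq_adjoint, ContinuousLinearMap.adjoint_inner_right]
  exact inner_self_nonneg (𝕜 := ℂ)

/-- The positive linear functional `f ↦ ⟨f(U) x, x⟩` on real continuous functions on the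
spectrum of `U`. -/
def spectralFunctional (U : unitary (H →L[ℂ] H)) (x : H) :
    CompactlySupportedContinuousMap (spectrum ℂ (U : H →L[ℂ] H)) ℝ →ₚ[ℝ] ℝ :=
  PositiveLinearMap.mk₀
    { toFun := fun f => (inner ℂ x (calculus U (toComplex f.toContinuousMap) x)).re
      map_add' := fun f g => by
        have h : toComplex (f + g).toContinuousMap =
            toComplex f.toContinuousMap + toComplex g.toContinuousMap := by
          ext t; simp [toComplex]
        rw [h, map_add, add_apply, inner_add_right, Complex.add_re]
      map_smul' := fun c f => by
        have h : toComplex (c • f).toContinuousMap =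
            (c : ℂ) • toComplex f.toContinuousMap := by
          ext t; simp [toComplex]
        rw [h, map_smul, smul_apply, inner_smul_right,
          Complex.re_ofReal_mul]
        simp }
    (fun f hf => calculus_nonneg U x f.toContinuousMap hf)

/-- The angle `θ ∈ [0, 2π)` with `exp (-iθ) = z`, for `z` on the unit circle. -/
def angle (z : ℂ) : ℝ := toIcoMod Real.two_pi_pos 0 (-Complex.arg z)

/-- The spectral measure `m_x` of the vector `x` for the unitary operator
`U = ∫ exp (-iθ) E(dθ)`, that is `m_x(S) = ⟨E(S) x, x⟩`. It is the Riesz–Markov measure of the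
functional `f ↦ ⟨f(U) x, x⟩`, transported from the spectrum of `U` to `[0, 2π)` by
`exp (-iθ) ↦ θ`. -/
def spectralMeasure (U : unitary (H →L[ℂ] H)) (x : H) : Measure ℝ :=
  (RealRMK.rieszMeasure (spectralFunctional U x)).map
    (fun z : spectrum ℂ (U : H →L[ℂ] H) => angle (z : ℂ))

/-- The part of `m_x` that is absolutely continuous with respect to Lebesgue measure. -/
def acPart (U : unitary (H →L[ℂ] H)) (x : H) : Measure ℝ :=
  (volume : Measure ℝ).withDensity ((spectralMeasure U x).rnDeriv volume)

/-- The part of `m_x` that is singular with respect to Lebesgue measure (the sum of the pure point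
and the singular continuous parts). -/
def singPart (U : unitary (H →L[ℂ] H)) (x : H) : Measure ℝ :=
  (spectralMeasure U x).singularPart volume

/-- `U` has no absolutely continuous spectrum in `J`: `m_x^ac(J) = 0` for every vector `x`. -/
def NoACSpectrumIn (U : unitary (H →L[ℂ] H)) (J : Set ℝ) : Prop :=
  ∀ x : H, acPart U x J = 0

/-- The singular spectrum of `U` in `J` is supported by `N`: `m_x^s(J ∖ N) = 0` for every
vector `x`. -/
def SingularSpectrumSupportedBy (U : unitary (H →L[ℂ] H)) (J N : Set ℝ) : Prop :=
  ∀ x : H, singPart U x (J \ N) = 0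

/-- The closed subspace `M` reduces `U`: `M` and its orthogonal complement are invariant. -/
def Reduces (U : unitary (H →L[ℂ] H)) (M : Submodule ℂ H) : Prop :=
  (∀ x ∈ M, (U : H →L[ℂ] H) x ∈ M) ∧ ∀ x ∈ Mᗮ, (U : H →L[ℂ] H) x ∈ Mᗮ

/-- `S` is cyclic for `U`: the smallest closed reducing subspace containing `S` is the whole
space. -/
def IsCyclicFor (U : unitary (H →L[ℂ] H)) (S : Set H) : Prop :=
  sInf {M : Submodule ℂ H | IsClosed (M : Set H) ∧ Reduces U M ∧ S ⊆ M} = ⊤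

/-- `F(z; U) = (1 - U exp (iz))⁻¹`, for complex `z`. -/
def resolvent (U : unitary (H →L[ℂ] H)) (z : ℂ) : H →L[ℂ] H :=
  Ring.inverse (1 - Complex.exp (Complex.I * z) • (U : H →L[ℂ] H))

end SpectralMeasure

section UFinite

variable {H K : Type*} [NormedAddCommGroup H] [InnerProductSpace ℂ H] [CompleteSpace H]
  [NormedAddCommGroup K] [InnerProductSpace ℂ K]

/-- Composition of partially defined operators, on its natural domain
`{x ∈ D(f) : f x ∈ D(g)}`. -/
def pcomp {E F G : Type*} [AddCommGroup E] [Module ℂ E] [AddCommGroup F] [Module ℂ F]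
    [AddCommGroup G] [Module ℂ G] (g : F →ₗ.[ℂ] G) (f : E →ₗ.[ℂ] F) : E →ₗ.[ℂ] G :=
  g.comp (f.domRestrict ((g.domain.comap f.toFun).map f.domain.subtype)) (by
    rintro ⟨x, hx, hxf⟩
    obtain ⟨y, hy, rfl⟩ := hx
    exact hy)

/-- The operator `G_ε(θ; U, A) = A F*(θ + iε; U) F(θ + iε; U) A*` on its natural domain. -/
def Gop (U : unitary (H →L[ℂ] H)) (A : H →ₗ.[ℂ] K) (ε θ : ℝ) : K →ₗ.[ℂ] K :=
  pcomp A
    (((star (resolvent U (θ + ε * Complex.I)) * resolvent U (θ + ε * Complex.I) :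
      H →L[ℂ] H) : H →ₗ[ℂ] H).compPMap A.adjoint)

/-- For every `ε > 0` the operator `G_ε(θ; U, A)` has a bounded extension to `K`, and these
extensions converge strongly as `ε ↓ 0`. -/
def StrongLimitExists (U : unitary (H →L[ℂ] H)) (A : H →ₗ.[ℂ] K) (θ : ℝ) : Prop :=
  ∃ B : ℝ → (K →L[ℂ] K),
    (∀ ε : ℝ, 0 < ε → Gop U A ε θ ≤ ((B ε : K →L[ℂ] K) : K →ₗ[ℂ] K).toPMap ⊤) ∧
    ∃ G : K →L[ℂ] K, ∀ x : K, Tendsto (fun ε => B ε x) (𝓝[>] 0) (𝓝 (G x))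

/-- `A` is `U`-finite on `J`. -/
def UFinite (U : unitary (H →L[ℂ] H)) (A : H →ₗ.[ℂ] K) (J : Set ℝ) : Prop :=
  ∀ᵐ θ ∂(volume : Measure ℝ), θ ∈ J → StrongLimitExists U A θ

/-- The set `N(U, A, J)` of those `θ ∈ J` at which the strong limit of `G_ε(θ; U, A)` fails to
exist. -/
def exceptionalSet (U : unitary (H →L[ℂ] H)) (A : H →ₗ.[ℂ] K) (J : Set ℝ) : Set ℝ :=
  {θ | θ ∈ J ∧ ¬ StrongLimitExists U A θ}

end UFinite

end

end Floquet

/-! Let F = F(θ + iε; U) and x = A* y. Formally ⟨y, G_ε(θ) y⟩ = ‖F x‖² is the integral of |1 -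
e^{i(θ+iε)} w|⁻² against the spectral measure of x, and the integrand is at least 1/(4ε²) where the
angle of w is within ε of θ. If the strong limit exists at θ, the left side stays bounded as ε ↓ 0,
so m_x([θ - ε, θ + ε]) = O(ε²) = o(ε) (`spectralMeasure_closedBall_le`). Thus m_x has zero
derivative at each point of J \ N, and m_x(J \ N) = 0 by a covering argument
(`measure_eq_zero_of_closedBall_le`). Vectors with this property form a closed reducing subspace, so
cyclicity extends it to all of H. Since N is Lebesgue null, both claims follow.

The delicate point is that y need not lie in the natural domain of G_ε, which is not assumed dense.
Von Neumann's theorem for the closed operator F A* shows that 1 + G_ε is onto; together with a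
bounded extension this forces G_ε to be everywhere defined (`exists_graph_of_bounded`). -/

namespace Floquet

/-! ### Closed operators: A F* F A* and its bounded extensions. -/

section AdjointGraph

variable {H K : Type*} [NormedAddCommGroup H] [InnerProductSpace ℂ H] [CompleteSpace H]
  [NormedAddCommGroup K] [InnerProductSpace ℂ K]

/-- Up to the rotation (a, b) ↦ (b, -a), the adjoint of a graph is its orthogonal complement, so the
double adjoint lies in gᗮᗮ = g. The ℓ² product supplies the Hilbert structure. -/
theorem mem_of_mem_adjoint_adjoint [CompleteSpace K] {g : Submodule ℂ (H × K)} (hg : IsClosed (g : Set (H × K)))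
    {w : H × K} (hw : w ∈ g.adjoint.adjoint) : w ∈ g := by
  set g' : Submodule ℂ (WithLp 2 (H × K)) :=
    g.comap (WithLp.linearEquiv 2 ℂ (H × K)).toLinearMap
  have hcl : IsClosed (g' : Set (WithLp 2 (H × K))) :=
    hg.preimage (WithLp.prod_continuous_ofLp 2 H K)
  have : CompleteSpace g' := hcl.completeSpace_coe
  have hmem : WithLp.toLp 2 w ∈ g'ᗮᗮ := by
    rw [Submodule.mem_orthogonal]
    intro q hq
    rw [Submodule.mem_orthogonal] at hq
    rw [Submodule.mem_adjoint_iff] at hw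
    have h := hw q.snd (-q.fst) (by
      rw [Submodule.mem_adjoint_iff]
      intro a b hab
      have h := hq (WithLp.toLp 2 (a, b)) hab
      simp only [WithLp.prod_inner_apply] at h
      simpa [add_comm] using h)
    simp only [WithLp.prod_inner_apply]
    simp only [inner_neg_left] at h
    simp only [WithLp.ofLp_fst, WithLp.ofLp_snd]
    linear_combination -h
  rw [Submodule.orthogonal_orthogonal] at hmem
  exact hmem

/-- Every vector of `K` has the form `u + A P A* u`, where `P = F* F` and `F = D⁻¹`. -/
theorem exists_add_eq [CompleteSpace K] (A : H →ₗ.[ℂ] K) (hA_dense : Dense (A.domain : Set H))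
    (hA_closed : A.IsClosed) (F D : H →L[ℂ] H) (hDF : D * F = 1) (hFD : F * D = 1) (y : K) :
    ∃ (u k : K) (h : H), (u, h) ∈ A.adjoint.graph ∧ ((star F * F) h, k) ∈ A.graph ∧ y = u + k := by
  have hDF' : ∀ x, D (F x) = x := fun x => DFunLike.congr_fun hDF x
  have hFD' : ∀ x, F (D x) = x := fun x => DFunLike.congr_fun hFD x
  -- The graph of F A* is the preimage of the graph of A* under (a, p) ↦ (a, D p), hence closed.
  let L : WithLp 2 (K × H) →ₗ[ℂ] K × H :=
    (LinearMap.prodMap LinearMap.id (D : H →ₗ[ℂ] H)) ∘ₗ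
      (WithLp.linearEquiv 2 ℂ (K × H)).toLinearMap
  have hL : Continuous L := by
    have h1 : Continuous fun p : K × H => (p.1, D p.2) := by fun_prop
    exact h1.comp (WithLp.prod_continuous_ofLp 2 K H)
  set g : Submodule ℂ (WithLp 2 (K × H)) := A.adjoint.graph.comap L
  have hcl : IsClosed (g : Set (WithLp 2 (K × H))) :=
    (LinearPMap.adjoint_isClosed hA_dense).preimage hL
  have : CompleteSpace g := hcl.completeSpace_coe
  -- Von Neumann's argument: projecting gives (y, 0) = (u, F A* u) + (k, -F A* u), and orthogonality
  -- of the last term to the graph says k = (F A*)* F A* u = A F* F A* u.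
  obtain ⟨p, hp, q, hq, hpq⟩ := g.exists_add_mem_mem_orthogonal (WithLp.toLp 2 (y, (0 : H)))
  have h1 : y = p.fst + q.fst := congrArg WithLp.fst hpq
  have h2 : (0 : H) = p.snd + q.snd := congrArg WithLp.snd hpq
  have hpg : (p.fst, D p.snd) ∈ A.adjoint.graph := hp
  refine ⟨p.fst, q.fst, D p.snd, hpg, ?_, h1⟩
  apply mem_of_mem_adjoint_adjoint hA_closed
  rw [Submodule.mem_adjoint_iff, ← LinearPMap.adjoint_graph_eq_graph_adjoint hA_dense]
  intro a b hab
  have hmem : WithLp.toLp 2 (a, F b) ∈ g := by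
    change (a, D (F b)) ∈ A.adjoint.graph
    rwa [hDF']
  have h3 := (Submodule.mem_orthogonal _ _).1 hq _ hmem
  simp only [WithLp.prod_inner_apply] at h3
  have h4 : q.snd = -p.snd := by
    rw [eq_neg_iff_add_eq_zero, add_comm]; exact h2.symm
  have h5 : (star F * F) (D p.snd) = star F p.snd := by
    change star F (F (D p.snd)) = _
    rw [hFD']
  change inner ℂ b ((star F * F) (D p.snd)) - inner ℂ a q.fst = 0
  rw [h5, ContinuousLinearMap.star_eq_adjoint, ContinuousLinearMap.adjoint_inner_right]
  simp only [WithLp.ofLp_fst, WithLp.ofLp_snd, h4, inner_neg_right] at h3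
  linear_combination -h3

/-- Moving A across the inner product leaves ⟨F* F h, h⟩. This yields both the positivity of the
extension and the bound on the resolvent. -/
theorem inner_graph_eq_norm_sq (A : H →ₗ.[ℂ] K) (hA_dense : Dense (A.domain : Set H))
    (F : H →L[ℂ] H) {u k : K} {h : H} (hu : (u, h) ∈ A.adjoint.graph)
    (hk : ((star F * F) h, k) ∈ A.graph) : inner ℂ u k = (‖F h‖ : ℂ) ^ 2 := by
  rw [LinearPMap.adjoint_graph_eq_graph_adjoint hA_dense, Submodule.mem_adjoint_iff] at hu
  have h1 := hu _ _ hk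
  rw [sub_eq_zero] at h1
  have h2 : inner ℂ ((star F * F) h) h = (‖F h‖ : ℂ) ^ 2 := by
    change inner ℂ (star F (F h)) h = _
    rw [ContinuousLinearMap.star_eq_adjoint, ContinuousLinearMap.adjoint_inner_left]
    exact inner_self_eq_norm_sq_to_K (𝕜 := ℂ) (F h)
  rw [← inner_conj_symm]
  simp only at h1
  rw [h1, h2]
  simp

/-- If `A F* F A*` has a bounded extension, then it is everywhere defined. -/
theorem exists_graph_of_bounded [CompleteSpace K] (A : H →ₗ.[ℂ] K) (hA_dense : Dense (A.domain : Set H))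
    (hA_closed : A.IsClosed) (F D : H →L[ℂ] H) (hDF : D * F = 1) (hFD : F * D = 1)
    (B : K →L[ℂ] K) (hB : ∀ (u k : K) (h : H), (u, h) ∈ A.adjoint.graph →
      ((star F * F) h, k) ∈ A.graph → B u = k) (y : K) :
    ∃ h : H, (y, h) ∈ A.adjoint.graph ∧ ((star F * F) h, B y) ∈ A.graph := by
  -- S is the natural domain of A F* F A*; the aim is S = K.
  set S : Set K := {u | ∃ h, (u, h) ∈ A.adjoint.graph ∧ ((star F * F) h, B u) ∈ A.graph}
  have hre : ∀ u ∈ S, 0 ≤ (inner ℂ u (B u)).re := by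
    rintro u ⟨h, hu, hk⟩
    rw [inner_graph_eq_norm_sq A hA_dense F hu hk, ← Complex.ofReal_pow, Complex.ofReal_re]
    positivity
  have hsurj : ∀ y, ∃ u ∈ S, y = u + B u := by
    intro y
    obtain ⟨u, k, h, hu, hk, rfl⟩ := exists_add_eq A hA_dense hA_closed F D hDF hFD y
    have := hB u k h hu hk
    subst this
    exact ⟨u, ⟨h, hu, hk⟩, rfl⟩
  have hdense : Dense S := by
    let M : Submodule ℂ K :=
      { carrier := S
        zero_mem' := ⟨0, Submodule.zero_mem _, by simp⟩
        add_mem' := by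
          rintro a b ⟨h, h1, h2⟩ ⟨h', h1', h2'⟩
          refine ⟨h + h', Submodule.add_mem _ h1 h1', ?_⟩
          rw [map_add, map_add]
          exact Submodule.add_mem _ h2 h2'
        smul_mem' := by
          rintro c a ⟨h, h1, h2⟩
          refine ⟨c • h, Submodule.smul_mem _ c h1, ?_⟩
          rw [map_smul, map_smul]
          exact Submodule.smul_mem _ c h2 }
    change Dense (M : Set K)
    rw [Submodule.dense_iff_topologicalClosure_eq_top,
      Submodule.topologicalClosure_eq_top_iff,
      Submodule.eq_bot_iff]
    intro h hh
    -- A vector orthogonal to S is itself u + B u with u in S, so ‖u‖² + ⟨u, B u⟩ = 0 and u = 0.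
    obtain ⟨u, hu, rfl⟩ := hsurj h
    have h0 := (Submodule.mem_orthogonal _ _).1 hh u hu
    rw [inner_add_right] at h0
    have h1 := congrArg Complex.re h0
    have h2 : (inner ℂ u u).re = ‖u‖ ^ 2 := inner_self_eq_norm_sq (𝕜 := ℂ) u
    rw [Complex.add_re, h2, Complex.zero_re] at h1
    have h3 := hre u hu
    have : u = 0 := by
      rw [← norm_eq_zero]
      nlinarith [sq_nonneg ‖u‖]
    simp [this]
  have hre' : ∀ u, 0 ≤ (inner ℂ u (B u)).re := by
    have hc : IsClosed {u : K | 0 ≤ (inner ℂ u (B u)).re} :=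
      isClosed_le continuous_const (by fun_prop)
    intro u
    exact hc.closure_subset_iff.2 hre (hdense u)
  -- Positivity makes 1 + B injective on K, while 1 + B already maps S onto K; hence y lies in S.
  obtain ⟨u, hu, huy⟩ := hsurj (y + B y)
  have h1 : (u - y) + B (u - y) = 0 := by
    rw [map_sub]
    have : u - y + (B u - B y) = (u + B u) - (y + B y) := by abel
    rw [this, ← huy, sub_self]
  have h2 : u - y = 0 := by
    have h0 := congrArg (fun v => (inner ℂ (u - y) v).re) h1
    simp only [inner_add_right, Complex.add_re, inner_zero_right, Complex.zero_re] at h0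
    have h2 : (inner ℂ (u - y) (u - y)).re = ‖u - y‖ ^ 2 := inner_self_eq_norm_sq (𝕜 := ℂ) _
    have h3 := hre' (u - y)
    rw [← norm_eq_zero]
    nlinarith [sq_nonneg ‖u - y‖]
  rw [sub_eq_zero] at h2
  exact h2 ▸ hu

theorem apply_eq_of_Gop_le {U : unitary (H →L[ℂ] H)} {A : H →ₗ.[ℂ] K} {ε θ : ℝ} {B : K →L[ℂ] K}
    (hB : Gop U A ε θ ≤ (B : K →ₗ[ℂ] K).toPMap ⊤) {u k : K} {h : H}
    (hu : (u, h) ∈ A.adjoint.graph)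
    (hk : ((star (resolvent U (θ + ε * Complex.I)) * resolvent U (θ + ε * Complex.I)) h, k)
      ∈ A.graph) : B u = k := by
  obtain ⟨⟨u', hu'⟩, h1, h2⟩ := LinearPMap.mem_graph_iff _ |>.1 hu
  obtain ⟨⟨w, hw⟩, h3, h4⟩ := LinearPMap.mem_graph_iff _ |>.1 hk
  simp only at h1 h2 h3 h4
  subst h1 h2 h3
  have hdom : u' ∈ (Gop U A ε θ).domain :=
    ⟨⟨⟨u', hu'⟩, hw, rfl⟩, hu'⟩
  have h5 := hB.2 (x := ⟨u', hdom⟩) (y := ⟨u', trivial⟩) rfl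
  rw [← h4]
  exact h5.symm

end AdjointGraph


/-! ### Spectral measures as functions of the vector. -/

section Spectral

variable {H : Type*} [NormedAddCommGroup H] [InnerProductSpace ℂ H] [CompleteSpace H]

theorem measurable_angle : Measurable angle := by
  have h : angle = fun z => Int.fract (-Complex.arg z / (2 * Real.pi)) * (2 * Real.pi) := by
    funext z
    exact toIcoMod_eq_fract_mul Real.two_pi_pos _
  rw [h]
  exact (measurable_fract.comp (Complex.measurable_arg.neg.div_const _)).mul_const _

theorem exp_neg_angle {z : ℂ} (hz : ‖z‖ = 1) : Complex.exp (-(Complex.I * angle z)) = z := by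
  have h1 : angle z =
      -Complex.arg z - toIcoDiv Real.two_pi_pos 0 (-Complex.arg z) * (2 * Real.pi) := by
    rw [angle, toIcoMod, zsmul_eq_mul]
  have h2 : -(Complex.I * angle z) = Complex.arg z * Complex.I +
      (toIcoDiv Real.two_pi_pos 0 (-Complex.arg z) : ℤ) * (2 * Real.pi * Complex.I) := by
    rw [h1]; push_cast; ring
  rw [h2, Complex.exp_periodic.int_mul]
  have h3 := Complex.norm_mul_exp_arg_mul_I z
  rwa [hz, Complex.ofReal_one, one_mul] at h3

theorem norm_eq_one_of_mem_spectrum (U : unitary (H →L[ℂ] H))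
    (w : spectrum ℂ (U : H →L[ℂ] H)) : ‖(w : ℂ)‖ = 1 := by
  simpa using spectrum.subset_circle_of_unitary U.2 w.2

theorem measurable_angle_coe (U : unitary (H →L[ℂ] H)) :
    Measurable fun w : spectrum ℂ (U : H →L[ℂ] H) => angle (w : ℂ) :=
  measurable_angle.comp measurable_subtype_coe

/-- The spectral measure of `x` on the spectrum of `U`. -/
noncomputable abbrev spectrumMeasure (U : unitary (H →L[ℂ] H)) (x : H) :
    Measure (spectrum ℂ (U : H →L[ℂ] H)) :=
  RealRMK.rieszMeasure (spectralFunctional U x)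

theorem integral_spectrumMeasure (U : unitary (H →L[ℂ] H)) (x : H)
    (f : C(spectrum ℂ (U : H →L[ℂ] H), ℝ)) :
    ∫ w, f w ∂(spectrumMeasure U x) = (inner ℂ x (calculus U (toComplex f) x)).re :=
  RealRMK.integral_rieszMeasure (spectralFunctional U x)
    (CompactlySupportedContinuousMap.continuousMapEquiv f)

theorem spectrumMeasure_ext (U : unitary (H →L[ℂ] H))
    {μ ν : Measure (spectrum ℂ (U : H →L[ℂ] H))} [IsFiniteMeasure μ] [IsFiniteMeasure ν]
    (h : ∀ f : C(spectrum ℂ (U : H →L[ℂ] H), ℝ), ∫ w, f w ∂μ = ∫ w, f w ∂ν) : μ = ν :=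
  ext_of_forall_integral_eq_of_IsFiniteMeasure fun f => h f.toContinuousMap

theorem integrable_spectrum {U : unitary (H →L[ℂ] H)}
    (μ : Measure (spectrum ℂ (U : H →L[ℂ] H))) [IsFiniteMeasure μ]
    (f : C(spectrum ℂ (U : H →L[ℂ] H), ℝ)) : Integrable (fun w => f w) μ :=
  f.continuous.integrable_of_hasCompactSupport (HasCompactSupport.of_compactSpace _)

/-- The parallelogram law for the quadratic form x ↦ ⟨f(U) x, x⟩. It controls m_{x+y} without
spectral projections or complex measures. -/
theorem spectrumMeasure_add_add_sub (U : unitary (H →L[ℂ] H)) (x y : H) :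
    spectrumMeasure U (x + y) + spectrumMeasure U (x - y) =
      (2 : NNReal) • spectrumMeasure U x + (2 : NNReal) • spectrumMeasure U y := by
  apply spectrumMeasure_ext
  intro f
  rw [integral_add_measure (integrable_spectrum _ f) (integrable_spectrum _ f),
    integral_add_measure (integrable_spectrum _ f) (integrable_spectrum _ f),
    integral_smul_nnreal_measure, integral_smul_nnreal_measure]
  simp only [integral_spectrumMeasure, map_add, map_sub, inner_add_left, inner_add_right,
    inner_sub_left, inner_sub_right, Complex.add_re, Complex.sub_re, NNReal.smul_def, smul_eq_mul,
    NNReal.coe_ofNat]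
  ring

theorem spectrumMeasure_smul (U : unitary (H →L[ℂ] H)) (c : ℂ) (x : H) :
    spectrumMeasure U (c • x) = (‖c‖₊ ^ 2) • spectrumMeasure U x := by
  apply spectrumMeasure_ext
  intro f
  rw [integral_smul_nnreal_measure, integral_spectrumMeasure, integral_spectrumMeasure, map_smul,
    inner_smul_left, inner_smul_right, ← mul_assoc, ← Complex.normSq_eq_conj_mul_self,
    Complex.re_ofReal_mul, Complex.normSq_eq_norm_sq, NNReal.smul_def]
  simp

theorem calculus_id (U : unitary (H →L[ℂ] H)) :
    calculus U ((ContinuousMap.id ℂ).restrict (spectrum ℂ (U : H →L[ℂ] H))) = U :=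
  cfcHom_id _

theorem calculus_commute (U : unitary (H →L[ℂ] H)) (f : C(spectrum ℂ (U : H →L[ℂ] H), ℂ)) :
    calculus U f * U = U * calculus U f := by
  have h := (Commute.all f ((ContinuousMap.id ℂ).restrict _)).map (calculus U)
  rwa [calculus_id] at h

theorem spectrumMeasure_apply_unitary (U : unitary (H →L[ℂ] H)) (x : H) :
    spectrumMeasure U ((U : H →L[ℂ] H) x) = spectrumMeasure U x := by
  apply spectrumMeasure_ext
  intro f
  rw [integral_spectrumMeasure, integral_spectrumMeasure]
  have h1 : calculus U (toComplex f) ((U : H →L[ℂ] H) x) =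
      (U : H →L[ℂ] H) (calculus U (toComplex f) x) :=
    DFunLike.congr_fun (calculus_commute U (toComplex f)) x
  have h2 : ∀ v, ContinuousLinearMap.adjoint (U : H →L[ℂ] H) ((U : H →L[ℂ] H) v) = v := fun v =>
    DFunLike.congr_fun (Unitary.star_mul_self_of_mem U.2) v
  rw [h1, ← ContinuousLinearMap.adjoint_inner_right, h2]

theorem spectrumMeasure_univ (U : unitary (H →L[ℂ] H)) (x : H) :
    spectrumMeasure U x Set.univ = ENNReal.ofReal (‖x‖ ^ 2) := by
  have h := integral_spectrumMeasure U x 1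
  have h1 : toComplex (1 : C(spectrum ℂ (U : H →L[ℂ] H), ℝ)) = 1 := by
    ext; simp [toComplex]
  have h2 : (inner ℂ x x).re = ‖x‖ ^ 2 := inner_self_eq_norm_sq (𝕜 := ℂ) x
  rw [h1, map_one, one_apply_eq_self, h2] at h
  simp only [ContinuousMap.one_apply, integral_const, smul_eq_mul, mul_one] at h
  rw [← h, Measure.real, ENNReal.ofReal_toReal (measure_ne_top _ _)]

theorem spectralMeasure_eq (U : unitary (H →L[ℂ] H)) (x : H) : spectralMeasure U x =
    (spectrumMeasure U x).map (fun w : spectrum ℂ (U : H →L[ℂ] H) => angle (w : ℂ)) := rfl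

instance (U : unitary (H →L[ℂ] H)) (x : H) : IsFiniteMeasure (spectralMeasure U x) := by
  rw [spectralMeasure_eq]; infer_instance

theorem spectralMeasure_add_le (U : unitary (H →L[ℂ] H)) (x y : H) :
    spectralMeasure U (x + y) ≤
      (2 : NNReal) • spectralMeasure U x + (2 : NNReal) • spectralMeasure U y := by
  simp only [spectralMeasure_eq]
  rw [← Measure.map_smul, ← Measure.map_smul, ← Measure.map_add _ _ (measurable_angle_coe U),
    ← spectrumMeasure_add_add_sub]
  exact Measure.map_mono (Measure.le_add_right le_rfl) (measurable_angle_coe U)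

theorem spectralMeasure_smul (U : unitary (H →L[ℂ] H)) (c : ℂ) (x : H) :
    spectralMeasure U (c • x) = (‖c‖₊ ^ 2) • spectralMeasure U x := by
  simp only [spectralMeasure_eq]
  rw [← Measure.map_smul, spectrumMeasure_smul]

theorem spectralMeasure_le (U : unitary (H →L[ℂ] H)) (x : H) (S : Set ℝ) :
    spectralMeasure U x S ≤ ENNReal.ofReal (‖x‖ ^ 2) := by
  refine (measure_mono (Set.subset_univ S)).trans ?_
  rw [spectralMeasure_eq, Measure.map_apply (measurable_angle_coe U) MeasurableSet.univ,
    Set.preimage_univ, spectrumMeasure_univ]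

/-- The vectors whose spectral measure does not charge `S`. -/
def nullVectors (U : unitary (H →L[ℂ] H)) (S : Set ℝ) : Submodule ℂ H where
  carrier := {x | spectralMeasure U x S = 0}
  zero_mem' := by
    have h := spectralMeasure_le U 0 S
    simpa using h
  add_mem' := by
    intro x y hx hy
    have h := spectralMeasure_add_le U x y S
    simp only [Set.mem_ofPred_eq] at hx hy ⊢
    simpa [hx, hy] using h
  smul_mem' := by
    intro c x hx
    simp only [Set.mem_ofPred_eq] at hx ⊢
    rw [spectralMeasure_smul]
    simp [hx]

theorem mem_nullVectors {U : unitary (H →L[ℂ] H)} {S : Set ℝ} {x : H} :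
    x ∈ nullVectors U S ↔ spectralMeasure U x S = 0 := Iff.rfl

theorem apply_mem_nullVectors_iff {U : unitary (H →L[ℂ] H)} {S : Set ℝ} {x : H} :
    (U : H →L[ℂ] H) x ∈ nullVectors U S ↔ x ∈ nullVectors U S := by
  simp only [mem_nullVectors, spectralMeasure_eq, spectrumMeasure_apply_unitary]

theorem isClosed_nullVectors (U : unitary (H →L[ℂ] H)) (S : Set ℝ) :
    IsClosed (nullVectors U S : Set H) := by
  refine isClosed_of_closure_subset fun x hx => ?_
  rw [SetLike.mem_coe, mem_nullVectors, ← nonpos_iff_eq_zero]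
  obtain ⟨u, hu, hlim⟩ := mem_closure_iff_seq_limit.1 hx
  -- Split x = (x - u n) + u n; the second term contributes nothing, the first at most its total
  -- mass.
  have h1 : ∀ n, spectralMeasure U x S ≤ 2 * ENNReal.ofReal (‖x - u n‖ ^ 2) := by
    intro n
    have h := spectralMeasure_add_le U (x - u n) (u n) S
    have h0 : spectralMeasure U (u n) S = 0 := hu n
    rw [sub_add_cancel] at h
    simp only [Measure.coe_add, Pi.add_apply, Measure.smul_apply, h0, smul_zero, add_zero] at h
    refine h.trans ?_
    rw [ENNReal.smul_def, smul_eq_mul]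
    exact mul_le_mul' (by simp) (spectralMeasure_le U _ S)
  have h2 : Tendsto (fun n => 2 * ENNReal.ofReal (‖x - u n‖ ^ 2)) atTop (𝓝 0) := by
    have h3 : Tendsto (fun n => ‖x - u n‖ ^ 2) atTop (𝓝 0) := by
      have := ((tendsto_const_nhds (x := x)).sub hlim).norm.pow 2
      simpa using this
    have h4 := ENNReal.tendsto_ofReal h3
    rw [ENNReal.ofReal_zero] at h4
    simpa using ENNReal.Tendsto.const_mul h4 (Or.inr (by simp : (2 : ENNReal) ≠ ⊤))
  exact ge_of_tendsto' h2 h1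

/-- As x and U x have the same spectral measure, the subspace is invariant under U* as well as U, so
its complement is invariant under U. -/
theorem reduces_nullVectors (U : unitary (H →L[ℂ] H)) (S : Set ℝ) :
    Reduces U (nullVectors U S) := by
  refine ⟨fun x hx => apply_mem_nullVectors_iff.2 hx, fun x hx => ?_⟩
  rw [Submodule.mem_orthogonal] at hx ⊢
  intro u hu
  rw [← ContinuousLinearMap.adjoint_inner_left]
  apply hx
  have h2 : (U : H →L[ℂ] H) (ContinuousLinearMap.adjoint (U : H →L[ℂ] H) u) = u :=
    DFunLike.congr_fun (Unitary.mul_star_self_of_mem U.2) u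
  rwa [← apply_mem_nullVectors_iff, h2]

theorem spectralMeasure_eq_zero_of_cyclic {U : unitary (H →L[ℂ] H)} {R : Set H} {S : Set ℝ}
    (hR : IsCyclicFor U R) (h : ∀ x ∈ R, spectralMeasure U x S = 0) (x : H) :
    spectralMeasure U x S = 0 := by
  have hle : (⊤ : Submodule ℂ H) ≤ nullVectors U S := by
    rw [← show _ = ⊤ from hR]
    exact sInf_le ⟨isClosed_nullVectors U S, reduces_nullVectors U S, h⟩
  exact hle trivial

/-! ### Resolvent bounds on the mass of small intervals. -/

theorem norm_one_sub_exp_le {z : ℂ} (hz : z.re ≤ 0) : ‖1 - Complex.exp z‖ ≤ ‖z‖ := by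
  have h := (convex_halfSpace_re_le 0).norm_image_sub_le_of_norm_hasDerivWithin_le
    (𝕜 := ℂ) (f := Complex.exp) (f' := Complex.exp) (C := 1) (x := z) (y := 0)
    (fun w _ => (Complex.hasDerivAt_exp w).hasDerivWithinAt)
    (fun w hw => by rw [Complex.norm_exp]; exact Real.exp_le_one_iff.2 hw) hz (by simp)
  simpa using h

theorem one_sub_mul_ne_zero (U : unitary (H →L[ℂ] H)) {a : ℂ} (ha : ‖a‖ < 1)
    (w : spectrum ℂ (U : H →L[ℂ] H)) : 1 - a * (w : ℂ) ≠ 0 := by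
  intro h
  have h1 := congrArg norm (sub_eq_zero.1 h)
  rw [norm_one, norm_mul, norm_eq_one_of_mem_spectrum, mul_one] at h1
  exact ha.ne h1.symm

/-- The function `w ↦ 1 - a w` on the spectrum of `U`. -/
def oneSub (U : unitary (H →L[ℂ] H)) (a : ℂ) : C(spectrum ℂ (U : H →L[ℂ] H), ℂ) :=
  ⟨fun w => 1 - a * (w : ℂ), by fun_prop⟩

/-- The function `w ↦ (1 - a w)⁻¹` on the spectrum of `U`. -/
noncomputable def oneSubInv (U : unitary (H →L[ℂ] H)) {a : ℂ} (ha : ‖a‖ < 1) :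
    C(spectrum ℂ (U : H →L[ℂ] H), ℂ) :=
  ⟨fun w => (1 - a * (w : ℂ))⁻¹,
    Continuous.inv₀ (by fun_prop) (one_sub_mul_ne_zero U ha)⟩

theorem calculus_oneSub (U : unitary (H →L[ℂ] H)) (a : ℂ) :
    calculus U (oneSub U a) = 1 - a • (U : H →L[ℂ] H) := by
  have h : oneSub U a = 1 - a • (ContinuousMap.id ℂ).restrict (spectrum ℂ (U : H →L[ℂ] H)) := by
    ext w; simp [oneSub]
  rw [h, map_sub, map_one, map_smul, calculus_id]

theorem oneSub_mul_oneSubInv (U : unitary (H →L[ℂ] H)) {a : ℂ} (ha : ‖a‖ < 1) :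
    oneSub U a * oneSubInv U ha = 1 := by
  ext w
  exact mul_inv_cancel₀ (one_sub_mul_ne_zero U ha w)

theorem norm_exp_lt_one (θ : ℝ) {ε : ℝ} (hε : 0 < ε) :
    ‖Complex.exp (Complex.I * (θ + ε * Complex.I))‖ < 1 := by
  rw [Complex.norm_exp]
  simpa using hε

theorem calculus_oneSub_mul_inv (U : unitary (H →L[ℂ] H)) {a : ℂ} (ha : ‖a‖ < 1) :
    (1 - a • (U : H →L[ℂ] H)) * calculus U (oneSubInv U ha) = 1 := by
  rw [← calculus_oneSub, ← map_mul, oneSub_mul_oneSubInv, map_one]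

theorem calculus_inv_mul_oneSub (U : unitary (H →L[ℂ] H)) {a : ℂ} (ha : ‖a‖ < 1) :
    calculus U (oneSubInv U ha) * (1 - a • (U : H →L[ℂ] H)) = 1 := by
  rw [← calculus_oneSub, ← map_mul, mul_comm, oneSub_mul_oneSubInv, map_one]

theorem resolvent_eq_calculus (U : unitary (H →L[ℂ] H)) (θ : ℝ) {ε : ℝ} (hε : 0 < ε) :
    resolvent U (θ + ε * Complex.I) = calculus U (oneSubInv U (norm_exp_lt_one θ hε)) :=
  Ring.inverse_unit
    ⟨_, _, calculus_oneSub_mul_inv U (norm_exp_lt_one θ hε),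
      calculus_inv_mul_oneSub U (norm_exp_lt_one θ hε)⟩

theorem integral_normSq_eq (U : unitary (H →L[ℂ] H)) (x : H)
    (g : C(spectrum ℂ (U : H →L[ℂ] H), ℂ)) :
    ∫ w, ‖g w‖ ^ 2 ∂(spectrumMeasure U x) = ‖calculus U g x‖ ^ 2 := by
  let f : C(spectrum ℂ (U : H →L[ℂ] H), ℝ) := ⟨fun w => ‖g w‖ ^ 2, by fun_prop⟩
  have hf : toComplex f = star g * g := by
    ext w
    simp [toComplex, f, ← Complex.normSq_eq_conj_mul_self, Complex.normSq_eq_norm_sq]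
  have h := integral_spectrumMeasure U x f
  rw [hf, map_mul, map_star, mul_apply_eq_comp,
    ContinuousLinearMap.star_eq_adjoint, ContinuousLinearMap.adjoint_inner_right] at h
  exact h.trans (inner_self_eq_norm_sq (𝕜 := ℂ) _)

theorem spectralMeasure_closedBall_le (U : unitary (H →L[ℂ] H)) (x : H) (θ : ℝ) {ε : ℝ}
    (hε : 0 < ε) : spectralMeasure U x (Metric.closedBall θ ε) ≤
      ENNReal.ofReal (4 * ε ^ 2 * ‖resolvent U (θ + ε * Complex.I) x‖ ^ 2) := by
  rw [resolvent_eq_calculus U θ hε, ← integral_normSq_eq, ← integral_const_mul, spectralMeasure_eq,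
    Measure.map_apply (measurable_angle_coe U) Metric.isClosed_closedBall.measurableSet]
  set g := oneSubInv U (norm_exp_lt_one θ hε)
  let f : C(spectrum ℂ (U : H →L[ℂ] H), ℝ) := ⟨fun w => 4 * ε ^ 2 * ‖g w‖ ^ 2, by fun_prop⟩
  have hf : 0 ≤ᵐ[spectrumMeasure U x] f :=
    Eventually.of_forall fun w => show 0 ≤ 4 * ε ^ 2 * ‖g w‖ ^ 2 by positivity
  refine le_trans ?_ (ofReal_integral_eq_lintegral_ofReal (integrable_spectrum _ f) hf).ge
  have hms : MeasurableSet ((fun w : spectrum ℂ (U : H →L[ℂ] H) => angle (w : ℂ)) ⁻¹'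
      Metric.closedBall θ ε) := measurable_angle_coe U Metric.isClosed_closedBall.measurableSet
  rw [← lintegral_indicator_one hms]
  refine lintegral_mono fun w => ?_
  refine Set.indicator_le' (fun w hw => ?_) (fun w _ => zero_le (a := ENNReal.ofReal (f w))) w
  rw [Pi.one_apply, ENNReal.one_le_ofReal]
  have hne := one_sub_mul_ne_zero U (norm_exp_lt_one θ hε) w
  -- The product is the exponential of i(θ - angle w) - ε, whose real part is negative and whose
  -- modulus is at most ε + ε. Only this upper bound is needed, so the jump of the angle at 2π does
  -- no harm.
  have h1 : ‖1 - Complex.exp (Complex.I * (θ + ε * Complex.I)) * (w : ℂ)‖ ≤ 2 * ε := by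
    rw [← exp_neg_angle (norm_eq_one_of_mem_spectrum U w), ← Complex.exp_add]
    have h2 : Complex.I * (θ + ε * Complex.I) + -(Complex.I * angle (w : ℂ)) =
        Complex.I * ((θ - angle (w : ℂ) : ℝ) : ℂ) - (ε : ℂ) := by
      push_cast
      linear_combination (ε : ℂ) * Complex.I_mul_I
    rw [h2]
    refine (norm_one_sub_exp_le (by simpa using hε.le)).trans ((norm_sub_le _ _).trans ?_)
    rw [norm_mul, Complex.norm_I, one_mul, Complex.norm_real, Complex.norm_real, Real.norm_eq_abs,
      Real.norm_eq_abs, abs_of_pos hε]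
    have h3 : |angle (w : ℂ) - θ| ≤ ε := hw
    rw [abs_sub_comm] at h3
    linarith
  have h4 : 0 < ‖1 - Complex.exp (Complex.I * (θ + ε * Complex.I)) * (w : ℂ)‖ := norm_pos_iff.2 hne
  change 1 ≤ 4 * ε ^ 2 * ‖(1 - Complex.exp (Complex.I * (θ + ε * Complex.I)) * (w : ℂ))⁻¹‖ ^ 2
  rw [norm_inv, inv_pow, ← div_eq_mul_inv, one_le_div (by positivity)]
  nlinarith

end Spectral

/-! ### Differentiation of measures. -/

/-- A finite measure does not charge a bounded set at whose points it is of second order. -/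
theorem measure_eq_zero_of_closedBall_le {μ : Measure ℝ} [IsFiniteMeasure μ] {S : Set ℝ}
    (hS : volume S ≠ ⊤)
    (h : ∀ θ ∈ S, ∃ C : ℝ, ∀ᶠ ε in 𝓝[>] (0 : ℝ),
      μ (Metric.closedBall θ ε) ≤ ENNReal.ofReal (C * ε ^ 2)) : μ S = 0 := by
  have key : ∀ δ : NNReal, 0 < δ → μ S ≤ δ * volume S := by
    intro δ hδ
    -- The covering must be efficient for μ, which may be singular, so the Vitali family is taken
    -- for μ and not for Lebesgue measure. The comparison C ε² ≤ δ · 2ε holds for small ε; S need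
    -- not be measurable.
    refine (Besicovitch.vitaliFamily μ).measure_le_of_frequently_le (δ • volume)
      Measure.AbsolutelyContinuous.rfl S fun θ hθ => ?_
    refine (Besicovitch.tendsto_filterAt μ θ).frequently (Eventually.frequently ?_)
    obtain ⟨C, hC⟩ := h θ hθ
    have hsmall : ∀ᶠ ε in 𝓝[>] (0 : ℝ), C * ε < 2 * δ := by
      have ht : Tendsto (fun ε : ℝ => C * ε) (𝓝[>] 0) (𝓝 0) := by
        have : Tendsto (fun ε : ℝ => C * ε) (𝓝 0) (𝓝 (C * 0)) :=
          (continuous_const.mul continuous_id).tendsto 0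
        rw [mul_zero] at this
        exact this.mono_left nhdsWithin_le_nhds
      exact ht.eventually_lt_const (by positivity)
    filter_upwards [hC, hsmall, self_mem_nhdsWithin] with ε h1 h2 h3
    have h3 : 0 < ε := h3
    refine h1.trans ?_
    rw [Measure.smul_apply, Real.volume_closedBall, ENNReal.smul_def, smul_eq_mul,
      ← ENNReal.ofReal_coe_nnreal, ← ENNReal.ofReal_mul δ.coe_nonneg]
    apply ENNReal.ofReal_le_ofReal
    nlinarith
  by_contra hne
  have h0 : Tendsto (fun δ : NNReal => (δ : ENNReal) * volume S) (𝓝[>] 0) (𝓝 0) := by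
    have h1 : Tendsto (fun δ : NNReal => (δ : ENNReal) * volume S) (𝓝 0)
        (𝓝 (((0 : NNReal) : ENNReal) * volume S)) :=
      ENNReal.Tendsto.mul_const (ENNReal.tendsto_coe.2 tendsto_id) (Or.inr hS)
    rw [ENNReal.coe_zero, zero_mul] at h1
    exact h1.mono_left nhdsWithin_le_nhds
  have h2 : μ S ≤ 0 := ge_of_tendsto h0 (by
    filter_upwards [self_mem_nhdsWithin] with δ hδ using key δ hδ)
  exact hne (nonpos_iff_eq_zero.1 h2)

/-! ### Bounded resolvents and the conclusion. -/

section Main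

variable {H K : Type*} [NormedAddCommGroup H] [InnerProductSpace ℂ H] [CompleteSpace H]
  [NormedAddCommGroup K] [InnerProductSpace ℂ K]

/-- The convergent quantity ⟨y, B ε y⟩ is eventually bounded, and it equals the squared norm because
y lies in the natural domain of G_ε. -/
theorem eventually_norm_resolvent_le [CompleteSpace K] {U : unitary (H →L[ℂ] H)}
    {A : H →ₗ.[ℂ] K}
    (hA_dense : Dense (A.domain : Set H)) (hA_closed : A.IsClosed) {θ : ℝ}
    (hθ : StrongLimitExists U A θ) (y : A.adjoint.domain) :
    ∃ C : ℝ, ∀ᶠ ε : ℝ in 𝓝[>] 0,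
      ‖resolvent U (θ + ε * Complex.I) (A.adjoint y)‖ ^ 2 ≤ C := by
  obtain ⟨B, hB, G, hG⟩ := hθ
  have hlim : Tendsto (fun ε : ℝ => (inner ℂ (y : K) (B ε y)).re) (𝓝[>] 0)
      (𝓝 (inner ℂ (y : K) (G y)).re) :=
    (Complex.continuous_re.tendsto _).comp (tendsto_const_nhds.inner (𝕜 := ℂ) (hG y))
  refine ⟨(inner ℂ (y : K) (G y)).re + 1, ?_⟩
  filter_upwards [hlim.eventually_lt_const (u := (inner ℂ (y : K) (G y)).re + 1) (lt_add_one _), self_mem_nhdsWithin] with ε h1 hε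
  have hε : 0 < ε := hε
  have h2 := resolvent_eq_calculus U θ hε
  obtain ⟨h, hy, hk⟩ := exists_graph_of_bounded A hA_dense hA_closed
    (resolvent U (θ + ε * Complex.I))
    (1 - Complex.exp (Complex.I * (θ + ε * Complex.I)) • (U : H →L[ℂ] H))
    (by rw [h2]; exact calculus_oneSub_mul_inv U _)
    (by rw [h2]; exact calculus_inv_mul_oneSub U _) (B ε)
    (fun u k h hu hk => apply_eq_of_Gop_le (hB ε hε) hu hk) y
  have h3 := inner_graph_eq_norm_sq A hA_dense _ hy hk
  have h4 : h = A.adjoint y := by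
    obtain ⟨y', h5, h6⟩ := (LinearPMap.mem_graph_iff _).1 hy
    have h7 : y' = y := Subtype.ext h5
    rw [← h7]
    exact h6.symm
  rw [h3, ← Complex.ofReal_pow, Complex.ofReal_re, h4] at h1
  exact h1.le

end Main

end Floquet

theorem mainTheorem5 {H K : Type*}
    [NormedAddCommGroup H] [InnerProductSpace ℂ H] [CompleteSpace H]
    [TopologicalSpace.SeparableSpace H]
    [NormedAddCommGroup K] [InnerProductSpace ℂ K] [CompleteSpace K]
    [TopologicalSpace.SeparableSpace K]
    (U : unitary (H →L[ℂ] H))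
    (A : H →ₗ.[ℂ] K) (hA_dense : Dense (A.domain : Set H)) (hA_closed : A.IsClosed)
    (J : Set ℝ) (hJ : J ⊆ Set.Ico 0 (2 * Real.pi))
    (hA_finite : Floquet.UFinite U A J)
    (hA_cyclic : Floquet.IsCyclicFor U (Set.range A.adjoint)) :
    Floquet.NoACSpectrumIn U J ∧
      MeasureTheory.volume (Floquet.exceptionalSet U A J) = 0 ∧
      Floquet.SingularSpectrumSupportedBy U J (Floquet.exceptionalSet U A J) := by
  set N := Floquet.exceptionalSet U A J
  have hN : volume N = 0 := by
    refine measure_mono_null (fun θ hθ => ?_) hA_finite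
    exact fun h => hθ.2 (h hθ.1)
  have hJN : ∀ x, Floquet.spectralMeasure U x (J \ N) = 0 := by
    refine Floquet.spectralMeasure_eq_zero_of_cyclic hA_cyclic ?_
    rintro _ ⟨y, rfl⟩
    refine Floquet.measure_eq_zero_of_closedBall_le ?_ fun θ hθ => ?_
    · exact measure_ne_top_of_subset (Set.sdiff_subset.trans hJ)
        (by rw [Real.volume_Ico]; exact ENNReal.ofReal_ne_top)
    · have hlim : Floquet.StrongLimitExists U A θ := by
        by_contra h
        exact hθ.2 ⟨hθ.1, h⟩
      obtain ⟨C, hC⟩ := Floquet.eventually_norm_resolvent_le hA_dense hA_closed hlim y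
      refine ⟨4 * C, ?_⟩
      filter_upwards [hC, self_mem_nhdsWithin] with ε h1 hε
      refine (Floquet.spectralMeasure_closedBall_le U _ θ hε).trans
        (ENNReal.ofReal_le_ofReal ?_)
      nlinarith [mul_le_mul_of_nonneg_left h1 (by positivity : 0 ≤ 4 * ε ^ 2)]
  refine ⟨fun x => ?_, hN, fun x => ?_⟩
  -- Off N the whole measure vanishes; on N absolute continuity suffices, since N is Lebesgue null.
  · have h1 : Floquet.acPart U x (J \ N) = 0 :=
      le_antisymm ((Measure.withDensity_rnDeriv_le _ _ _).trans (hJN x).le) zero_le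
    have h2 : Floquet.acPart U x N = 0 := withDensity_absolutelyContinuous _ _ hN
    refine measure_mono_null (t := (J \ N) ∪ N) (fun θ hθ => ?_) (measure_union_null h1 h2)
    by_cases h : θ ∈ N
    · exact Or.inr h
    · exact Or.inl ⟨hθ, h⟩
  · exact le_antisymm ((Measure.singularPart_le _ _ _).trans (hJN x).le) zero_le
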